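/- **Setting.** Let $\mathcal X\subset\mathbb R^d$ be a measurable set, $\lambda$ the Lebesgue measure, and $X_1,X_2,\dots$ i.i.d. random variables with values in $\mathcal X$, with law $F$ having density $f\ge 0$ with respect to $\lambda$ on $\mathcal X$. Let $\varepsilon,\delta\in(0,1)$. Put $$\alpha_f(t)=\mathbb P\{f(X)\ge t\},\quad \lambda_f(t)=\lambda\{x\in\mathcal X: f(x)\ge t\},\quad \alpha_f^{-1}(\alpha)=\inf\{t\in\mathbb R:\alpha_f(t)\le\alpha\},$$ $$MV^*(\alpha)=\lambda_f(\alpha_f^{-1}(\alpha)),\qquad Q^*(\alpha)=\inf\{t\in\mathbb R:\mathbb P\{f(X)\le t\}\ge 1-\alpha\},\qquad \alpha\in[0,1).$$ A minimum volume set $\Omega^*_\alpha$ is any minimizer of $\lambda(\Omega)$ over measurable $\Omega\subset\mathcal X$ with $F(\Omega)\ge\alpha$. Let $\mathcal G$ be a class of measurable subsets of $\mathcal X$ of finite Lebesgue measure, $\widehat F(\Omega)=\frac1n\sum_{i=1}^n\mathbb I\{X_i\in\Omega\}$, and $$\mathcal R_n=\mathbb E\Big[\sup_{\Omega\in\mathcal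 G}\frac1n\Big|\sum_{i=1}^n\epsilon_i\,\mathbb I\{X_i\in\Omega\}\Big|\Big],\qquad \phi_n(\delta)=2\mathcal R_n+\sqrt{\frac{\log(1/\delta)}{2n}},$$ where $\epsilon_1,\epsilon_2,\dots$ are i.i.d. Rademacher signs independent of the $X_i$. (This supremum and $\sup_{\Omega\in\mathcal G}|\widehat F(\Omega)-F(\Omega)|$ are supposed measurable.) **Assumptions.** (i) $f$ is bounded; (ii) $\mathbb P\{f(X)=t\}=0$ for all $t>0$; (iii) for every $\alpha\in[0,1-\varepsilon]$ the class $\mathcal G$ contains a minimum volume set $\Omega^*_\alpha$; (iv) there is a constant $C>0$ such that $\mathcal R_n\le Cn^{-1/2}$ for all $n\ge1$; (v) $MV^*$ is differentiable on $[0,1)$ (from the right at $0$) with derivative $MV^{*\prime}=1/Q^*$, and $\int_0^1(1+\log|MV^{*\prime}(\alpha)|)\,|MV^{*\prime}(\alpha)|\,d\alpha<\infty$. **Estimator.** For a sample of size $n$ and $\alpha\in[0,1-\varepsilon]$ let $\widehat\Omega_\alpha$ be a solution of $$\min_{\Omega\in\mathcal G}\lambda(\Omega)\quad\text{subject to}\quad\widehat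 F(\Omega)\ge\alpha-\phi_n(\delta)$$ (a solution is supposed to exist whenever some set in $\mathcal G$ satisfies the constraint; otherwise $\widehat\Omega_\alpha$ is arbitrary). Let $\alpha_{j,k}=k(1-\varepsilon)/2^j$, $I_{j,k}=[\alpha_{j,k},\alpha_{j,k+1})$, $j_{\max}=\lfloor\log n/\log2\rfloor+1$ and $\tau=5\phi_n(\delta)/Q^*(1-\varepsilon)$. Grow a binary tree from the root $I_{0,0}$ by splitting a node $I_{j,k}$ into $I_{j+1,2k}$ and $I_{j+1,2k+1}$ if and only if $j<j_{\max}$ and $\lambda(\widehat\Omega_{\alpha_{j,k+1}})-\lambda(\widehat\Omega_{\alpha_{j,k}})>\tau$, and let $$\widehat{MV}{}^*(\alpha)=\sum_{I_{j,k}\text{ leaf}}\lambda(\widehat\Omega_{\alpha_{j,k+1}})\,\mathbb I\{\alpha\in I_{j,k}\},\qquad\alpha\in[0,1-\varepsilon].$$ **Corollary.** For every $n\ge1$, with probability at least $1-\delta$, $$\sup_{\alpha\in[0,1-\varepsilon]}\big\{\widehat{MV}{}^*(\alpha)-MV^*(\alpha)\big\}\le\frac1{Q^*(1-\varepsilon)}\left(11\Big(\frac{2C}{\sqrt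 n}+\sqrt{\frac{\log(1/\delta)}{2n}}\Big)+\frac1n\right),$$ and the right-hand side is $O(n^{-1/2})$ as $n\to\infty$. -/

import Mathlib

open MeasureTheory ProbabilityTheory

noncomputable section

namespace MassVolume

/-- The probability law on `ℝ^d` carried by `𝒳` with Lebesgue density `f`. -/
def law {d : ℕ} (𝒳 : Set (EuclideanSpace ℝ (Fin d))) (f : EuclideanSpace ℝ (Fin d) → ℝ) :
    Measure (EuclideanSpace ℝ (Fin d)) :=
  (volume.restrict 𝒳).withDensity fun x => ENNReal.ofReal (f x)

section Curves

variable {d : ℕ} (𝒳 : Set (EuclideanSpace ℝ (Fin d))) (F : Measure (EuclideanSpace ℝ (Fin d)))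
  (s : EuclideanSpace ℝ (Fin d) → ℝ)

/-- Mass `α_s(t) = P(s(X) ≥ t)` of the level set of `s` at level `t`. -/
def levelMass (t : ℝ) : ℝ := F.real {x | t ≤ s x}

/-- Volume `λ_s(t)` of the level set `{x ∈ 𝒳 : s(x) ≥ t}`. -/
def levelVolume (t : ℝ) : ℝ := volume.real {x ∈ 𝒳 | t ≤ s x}

/-- Generalized inverse `α_s⁻¹(α) = inf {t : α_s(t) ≤ α}`. -/
def levelMassInv (α : ℝ) : ℝ := sInf {t : ℝ | levelMass F s t ≤ α}

/-- The Mass Volume curve `MV_s = λ_s ∘ α_s⁻¹`. -/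
def mvCurve (α : ℝ) : ℝ := levelVolume 𝒳 s (levelMassInv F s α)

/-- `Q(s, α)`: the quantile at level `1 - α` of the law of `s(X)`. -/
def upperQuantile (α : ℝ) : ℝ := sInf {t : ℝ | 1 - α ≤ F.real {x | s x ≤ t}}

end Curves

/-- The optimal curve `MV* = MV_f`. -/
def mvStar {d : ℕ} (𝒳 : Set (EuclideanSpace ℝ (Fin d))) (f : EuclideanSpace ℝ (Fin d) → ℝ) :
    ℝ → ℝ :=
  mvCurve 𝒳 (law 𝒳 f) f

/-- `Q*(α) = Q(f, α)`. -/
def qStar {d : ℕ} (𝒳 : Set (EuclideanSpace ℝ (Fin d))) (f : EuclideanSpace ℝ (Fin d) → ℝ) :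
    ℝ → ℝ :=
  upperQuantile (law 𝒳 f) f

/-- The space `L log L` on `(0,1)`. The integrand is bounded below, so that its integral is
finite exactly when it is integrable. -/
def MemLLogL (g : ℝ → ℝ) : Prop :=
  IntegrableOn (fun α => (1 + Real.log |g α|) * |g α|) (Set.Ioo 0 1) volume

/-- `Ω` is a minimum volume set of mass at least `α`: it minimizes the volume among the measurable
subsets of `𝒳` of `F`-mass at least `α`. -/
def IsMinVolumeSet {d : ℕ} (𝒳 : Set (EuclideanSpace ℝ (Fin d)))
    (F : Measure (EuclideanSpace ℝ (Fin d))) (α : ℝ) (Ω : Set (EuclideanSpace ℝ (Fin d))) : Prop :=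
  (Ω ⊆ 𝒳 ∧ MeasurableSet Ω ∧ α ≤ F.real Ω) ∧
    ∀ Ω' : Set (EuclideanSpace ℝ (Fin d)), Ω' ⊆ 𝒳 → MeasurableSet Ω' → α ≤ F.real Ω' →
      volume Ω ≤ volume Ω'

section Sample

variable {d n : ℕ}

/-- Empirical mass `(1/n) ∑ 𝟙{x_i ∈ A}` of a set `A` under the sample `x`. -/
def empMass (x : Fin n → EuclideanSpace ℝ (Fin d)) (A : Set (EuclideanSpace ℝ (Fin d))) : ℝ :=
  (1 / (n : ℝ)) * ∑ i, A.indicator (fun _ => (1 : ℝ)) (x i)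

/-- The uniform deviation `sup_{Ω ∈ 𝒢} |F̂(Ω) - F(Ω)|`. -/
def empDeviation (F : Measure (EuclideanSpace ℝ (Fin d)))
    (𝒢 : Set (Set (EuclideanSpace ℝ (Fin d)))) (x : Fin n → EuclideanSpace ℝ (Fin d)) : ℝ :=
  ⨆ Ω : 𝒢, |empMass x Ω.1 - F.real Ω.1|

/-- `Ω` solves the empirical problem: minimize the volume over the class `𝒢` subject to
`F̂(Ω) ≥ α - φ`. -/
def IsEmpMinVolumeSet (𝒢 : Set (Set (EuclideanSpace ℝ (Fin d))))
    (x : Fin n → EuclideanSpace ℝ (Fin d)) (φ α : ℝ)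
    (Ω : Set (EuclideanSpace ℝ (Fin d))) : Prop :=
  (Ω ∈ 𝒢 ∧ α - φ ≤ empMass x Ω) ∧
    ∀ Ω' ∈ 𝒢, α - φ ≤ empMass x Ω' → volume Ω ≤ volume Ω'

/-- `sup_{Ω ∈ 𝒢} (1/n) |∑ e_i 𝟙{x_i ∈ Ω}|`. -/
def rademacherSup (𝒢 : Set (Set (EuclideanSpace ℝ (Fin d))))
    (x : Fin n → EuclideanSpace ℝ (Fin d)) (e : Fin n → ℝ) : ℝ :=
  ⨆ Ω : 𝒢, (1 / (n : ℝ)) * |∑ i, e i * Ω.1.indicator (fun _ => (1 : ℝ)) (x i)|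

end Sample

/-- The law of a Rademacher sign. -/
def signLaw : Measure ℝ :=
  (1 / 2 : ENNReal) • Measure.dirac (1 : ℝ) + (1 / 2 : ENNReal) • Measure.dirac (-1 : ℝ)

/-- Joint law of `(X_1, …, X_n)` i.i.d. from `F` and of independent i.i.d. signs. -/
def sampleSignLaw {d : ℕ} (F : Measure (EuclideanSpace ℝ (Fin d))) (n : ℕ) :
    Measure ((Fin n → EuclideanSpace ℝ (Fin d)) × (Fin n → ℝ)) :=
  (Measure.pi fun _ : Fin n => F).prod (Measure.pi fun _ : Fin n => signLaw)

/-- The Rademacher average `R_n` of the class `𝒢`. -/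
def rademacherAvg {d : ℕ} (F : Measure (EuclideanSpace ℝ (Fin d)))
    (𝒢 : Set (Set (EuclideanSpace ℝ (Fin d)))) (n : ℕ) : ℝ :=
  ∫ p, rademacherSup 𝒢 p.1 p.2 ∂(sampleSignLaw F n)

/-- The penalty `φ_n(δ) = 2 R_n + √(log(1/δ) / (2n))`. -/
def penalty {d : ℕ} (F : Measure (EuclideanSpace ℝ (Fin d)))
    (𝒢 : Set (Set (EuclideanSpace ℝ (Fin d)))) (δ : ℝ) (n : ℕ) : ℝ :=
  2 * rademacherAvg F 𝒢 n + Real.sqrt (Real.log (1 / δ) / (2 * n))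

section Tree

/-- The dyadic level `α_{j,k} = k (1 - ε) / 2^j`. -/
def dyadicLevel (ε : ℝ) (j k : ℕ) : ℝ := k * (1 - ε) / 2 ^ j

/-- The maximal depth `⌊log n / log 2⌋ + 1`. -/
def maxDepth (n : ℕ) : ℕ := ⌊Real.log n / Real.log 2⌋₊ + 1

/- In what follows `v α` is the volume of the estimated minimum volume set of level `α`,
`τ` is the tolerance and `J` the maximal depth. -/
variable (ε τ : ℝ) (J : ℕ) (v : ℝ → ℝ)

/-- The empirical local error on the interval `I_{j,k} = [α_{j,k}, α_{j,k+1})`. -/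
def localError (j k : ℕ) : ℝ := v (dyadicLevel ε j (k + 1)) - v (dyadicLevel ε j k)

/-- The criterion under which the algorithm splits `I_{j,k}` into `I_{j+1,2k}`, `I_{j+1,2k+1}`. -/
def Splits (j k : ℕ) : Prop := j < J ∧ τ < localError ε v j k

/-- `I_{j,k}` is a node of the tree grown by the algorithm from the root `I_{0,0}`: a node
of depth `j + 1` is a child of a split node of depth `j`. -/
def IsNode : ℕ → ℕ → Prop
  | 0, k => k = 0
  | j + 1, k => IsNode j (k / 2) ∧ Splits ε τ J v j (k / 2)

/-- Terminal nodes. -/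
def IsLeaf (j k : ℕ) : Prop := IsNode ε τ J v j k ∧ ¬ Splits ε τ J v j k

open Classical in
/-- The piecewise constant output of the adaptive algorithm: the sum over the leaves `I_{j,k}` of
`v(α_{j,k+1}) 𝟙{α ∈ I_{j,k}}`. (All leaves have depth at most `J`.) -/
def treeEstimator (α : ℝ) : ℝ :=
  ∑ j ∈ Finset.range (J + 1), ∑ k ∈ Finset.range (2 ^ j),
    if IsLeaf ε τ J v j k ∧ α ∈ Set.Ico (dyadicLevel ε j k) (dyadicLevel ε j (k + 1))
    then v (dyadicLevel ε j (k + 1)) else 0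

end Tree

/-- The estimator of `MV*` computed from a sample of size `n` by the adaptive algorithm with
tolerance `τ`, where `Ωhat α` is the estimated minimum volume set of level `α`. -/
def mvHat {d : ℕ} (ε τ : ℝ) (n : ℕ) (Ωhat : ℝ → Set (EuclideanSpace ℝ (Fin d))) : ℝ → ℝ :=
  treeEstimator ε τ (maxDepth n) fun α => volume.real (Ωhat α)

end MassVolume

end

open MassVolume

/-! The argument is deterministic on the event that `|F̂(Ω) - F(Ω)| ≤ φ` for all `Ω` in the class.
There a true minimum volume set of level `β` satisfies the empirical constraint, so the estimated
volume `v β` is at most its volume, hence at most `MV*(β)`. Only this one-sided comparison is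
needed.

`MV*` is nondecreasing, and Lipschitz on `[0, 1 - ε]` with constant `K = 1 / Q*(1 - ε)`: two level
sets of masses `α ≤ β` differ by a band of mass `β - α` on which the density is at least `Q*(1 - ε)`
(`qStar_mvStar_spec`). A leaf of the tree that contains `α` arises in one of two ways. If the
tolerance stopped it, the value at its right endpoint exceeds the value at its left endpoint by at
most `τ`, and the latter is at most `MV*(α)`. If the depth stopped it, its length is at most `1/n`
and the Lipschitz bound costs `K/n`. The excess is thus at most `τ + K/n = K (5φ + 1/n)`
(`treeEstimator_sub_le`).

The event has probability at least `1 - δ` by McDiarmid's inequality around the mean deviation,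
which symmetrization bounds by `2 R_n` (`measure_penalty_lt_empDeviation_le`). McDiarmid is proved
by induction: given the first coordinate, the rest is sub-Gaussian around the conditional mean,
whose own fluctuation is controlled by Hoeffding's lemma, and the variance proxies add. -/

/-- Bounded differences give a sub-Gaussian deviation from the mean, for a function of finitely many
independent variables that is only almost everywhere measurable. -/
lemma hasSubgaussianMGF_of_boundedDifferences {E : Type*} [MeasurableSpace E] (μ : Measure E)
    [IsProbabilityMeasure μ] (c : NNReal) (B : ℝ) : ∀ (n : ℕ) (g : (Fin n → E) → ℝ),
    AEMeasurable g (Measure.pi fun _ => μ) → (∀ x, |g x| ≤ B) →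
    (∀ x i a, |g (Function.update x i a) - g x| ≤ c) →
    HasSubgaussianMGF (fun x => g x - ∫ y, g y ∂(Measure.pi fun _ : Fin n => μ))
      (n * (c / 2) ^ 2) (Measure.pi fun _ => μ) := by
  intro n
  induction n with
  | zero =>
    intro g _ _ _
    have h : (fun x : Fin 0 → E => g x - ∫ y, g y ∂(Measure.pi fun _ : Fin 0 => μ)) =
        fun _ => 0 := by
      funext x
      have : g = fun _ => g x := by funext y; rw [Subsingleton.elim y x]
      rw [this]; simp
    rw [h]
    simp
  | succ n ih =>
    intro g hg hB hd
    have hmp := (measurePreserving_piFinSuccAbove (fun _ : Fin (n + 1) => μ) 0).symm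
    set e := (MeasurableEquiv.piFinSuccAbove (fun _ : Fin (n + 1) => E) 0).symm
    set ν : Measure (Fin n → E) := Measure.pi fun _ => μ
    have he : ∀ a y, e (a, y) = Fin.cons a y := fun a y => by
      simp [e, MeasurableEquiv.piFinSuccAbove, Fin.consEquiv]
    set m := ∫ y, g y ∂(Measure.pi fun _ : Fin (n + 1) => μ) with hm
    have hG : AEMeasurable (fun p : E × (Fin n → E) => g (e p)) (μ.prod ν) :=
      hg.comp_quasiMeasurePreserving hmp.quasiMeasurePreserving
    have hGi : Integrable (fun p : E × (Fin n → E) => g (e p)) (μ.prod ν) :=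
      Integrable.of_bound hG.aestronglyMeasurable B (ae_of_all _ fun p => hB _)
    set h : E → ℝ := fun a => ∫ y, g (e (a, y)) ∂ν with hh
    have hmh : m = ∫ a, h a ∂μ := by
      rw [hm, ← hmp.integral_comp', integral_prod _ hGi]
    have hae : ∀ᵐ a ∂μ, AEMeasurable (fun y => g (e (a, y))) ν := by
      filter_upwards [hG.aestronglyMeasurable.prodMk_left] with a ha using ha.aemeasurable
    have hsub : ∀ᵐ a ∂μ, HasSubgaussianMGF (fun y => g (e (a, y)) - h a) (n * (c / 2) ^ 2) ν := by
      filter_upwards [hae] with a ha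
      refine ih (fun y => g (e (a, y))) ha (fun y => hB _) fun y i b => ?_
      have := hd (Fin.cons a y) i.succ b
      simp only [he]
      rwa [Fin.cons_update]
    have hhm : AEMeasurable h μ := hGi.aestronglyMeasurable.integral_prod_right'.aemeasurable
    -- the conditional mean has oscillation at most `c`
    have hosc : ∃ b : ℝ, ∀ᵐ a ∂μ, h a ∈ Set.Icc b (b + c) := by
      -- Only almost every section is measurable; on the others the integral defining `h` takes the
      -- default value 0, which may leave the window, so the infimum is taken over `s`.
      set s := {a | AEMeasurable (fun y => g (e (a, y))) ν}
      have hi : ∀ a ∈ s, Integrable (fun y => g (e (a, y))) ν := fun a ha =>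
        Integrable.of_bound ha.aestronglyMeasurable B (ae_of_all _ fun p => hB _)
      have hs : ∀ a ∈ s, ∀ a' ∈ s, h a - c ≤ h a' := by
        intro a ha a' ha'
        have h1 : h a - h a' = ∫ y, (g (e (a, y)) - g (e (a', y))) ∂ν :=
          (integral_sub (hi a ha) (hi a' ha')).symm
        have h2 : ∫ y, (g (e (a, y)) - g (e (a', y))) ∂ν ≤ ∫ _, (c : ℝ) ∂ν := by
          refine integral_mono ((hi a ha).sub (hi a' ha')) (integrable_const _) fun y => ?_
          have := hd (Fin.cons a' y) 0 a
          rw [Fin.update_cons_zero] at this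
          simpa only [he] using (le_abs_self _).trans this
        simp at h2
        linarith
      obtain ⟨a₀, ha₀⟩ : s.Nonempty := hae.exists
      have hbdd : BddBelow (h '' s) := ⟨h a₀ - c, by rintro _ ⟨a, ha, rfl⟩; exact hs a₀ ha₀ a ha⟩
      refine ⟨sInf (h '' s), ?_⟩
      filter_upwards [hae] with a ha
      refine ⟨csInf_le hbdd ⟨a, ha, rfl⟩, ?_⟩
      have : h a - c ≤ sInf (h '' s) :=
        le_csInf ⟨_, a₀, ha₀, rfl⟩ (by rintro _ ⟨a', ha', rfl⟩; exact hs a ha a' ha')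
      linarith
    obtain ⟨b, hb⟩ := hosc
    have hhs : HasSubgaussianMGF (fun a => h a - m) ((c / 2) ^ 2) μ := by
      have := hasSubgaussianMGF_of_mem_Icc hhm hb
      rwa [add_sub_cancel_left, NNReal.nnnorm_eq, ← hmh] at this
    have hint : ∀ t : ℝ, Integrable (fun x => Real.exp (t * (g x - m)))
        (Measure.pi fun _ : Fin (n + 1) => μ) := fun t => by
      refine integrable_exp_mul_of_mem_Icc (a := -B - m) (b := B - m) (hg.sub_const m)
        (ae_of_all _ fun x => ?_)
      have := abs_le.1 (hB x)
      constructor <;> linarith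
    refine ⟨hint, fun t => ?_⟩
    have hint' : Integrable (fun p : E × (Fin n → E) => Real.exp (t * (g (e p) - m))) (μ.prod ν) :=
      hmp.integrable_comp_of_integrable (hint t)
    calc mgf (fun x => g x - m) (Measure.pi fun _ : Fin (n + 1) => μ) t
        = ∫ p, Real.exp (t * (g (e p) - m)) ∂(μ.prod ν) :=
          (hmp.integral_comp' (g := fun x => Real.exp (t * (g x - m)))).symm
      _ = ∫ a, ∫ y, Real.exp (t * (g (e (a, y)) - m)) ∂ν ∂μ := integral_prod _ hint'
      _ ≤ ∫ a, Real.exp (t * (h a - m)) * Real.exp ((n * (c / 2) ^ 2 : NNReal) * t ^ 2 / 2) ∂μ := by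
          refine integral_mono_ae hint'.integral_prod_left
            ((hhs.integrable_exp_mul t).mul_const _) ?_
          filter_upwards [hsub] with a ha
          -- Split `g - m` into the deviation from the conditional mean and the deviation of that
          -- mean, which is constant in `y`.
          have : ∀ y, Real.exp (t * (g (e (a, y)) - m)) =
              Real.exp (t * (h a - m)) * Real.exp (t * (g (e (a, y)) - h a)) := fun y => by
            rw [← Real.exp_add]; ring_nf
          simp only [this]
          rw [integral_const_mul]
          exact mul_le_mul_of_nonneg_left (ha.mgf_le t) (Real.exp_pos _).le
      _ = mgf (fun a => h a - m) μ t * Real.exp ((n * (c / 2) ^ 2 : NNReal) * t ^ 2 / 2) := by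
          rw [integral_mul_const]; rfl
      _ ≤ Real.exp (((c / 2) ^ 2 : NNReal) * t ^ 2 / 2) *
            Real.exp ((n * (c / 2) ^ 2 : NNReal) * t ^ 2 / 2) :=
          mul_le_mul_of_nonneg_right (hhs.mgf_le t) (Real.exp_pos _).le
      _ = Real.exp (((n + 1 : ℕ) * (c / 2) ^ 2 : NNReal) * t ^ 2 / 2) := by
          rw [← Real.exp_add]; push_cast; ring_nf

/-! ### Concentration and symmetrization of the uniform deviation -/

section EmpiricalProcess

variable {d n : ℕ} {F : Measure (EuclideanSpace ℝ (Fin d))}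
  {𝒢 : Set (Set (EuclideanSpace ℝ (Fin d)))}

lemma indicator_one_mem_Icc {α : Type*} (A : Set α) (a : α) :
    A.indicator (fun _ => (1 : ℝ)) a ∈ Set.Icc (0 : ℝ) 1 := by
  by_cases h : a ∈ A <;> simp [h]

lemma empMass_mem_Icc (x : Fin n → EuclideanSpace ℝ (Fin d)) (A : Set (EuclideanSpace ℝ (Fin d))) :
    empMass x A ∈ Set.Icc (0 : ℝ) 1 := by
  unfold empMass
  have h0 : 0 ≤ ∑ i, A.indicator (fun _ => (1 : ℝ)) (x i) :=
    Finset.sum_nonneg fun i _ => (indicator_one_mem_Icc A (x i)).1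
  have h1 : ∑ i, A.indicator (fun _ => (1 : ℝ)) (x i) ≤ n := by
    simpa using Finset.sum_le_sum fun i (_ : i ∈ Finset.univ) => (indicator_one_mem_Icc A (x i)).2
  refine ⟨by positivity, ?_⟩
  rw [one_div_mul_eq_div]
  exact div_le_one_of_le₀ h1 (Nat.cast_nonneg n)

lemma abs_empMass_sub_le [IsProbabilityMeasure F] (x : Fin n → EuclideanSpace ℝ (Fin d))
    (A : Set (EuclideanSpace ℝ (Fin d))) : |empMass x A - F.real A| ≤ 1 := by
  have h := empMass_mem_Icc x A
  have h1 : F.real A ≤ 1 := measureReal_le_one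
  have h0 : 0 ≤ F.real A := measureReal_nonneg
  rw [abs_le]
  constructor <;> linarith [h.1, h.2]

lemma bddAbove_empDeviation [IsProbabilityMeasure F] (x : Fin n → EuclideanSpace ℝ (Fin d)) :
    BddAbove (Set.range fun Ω : 𝒢 => |empMass x Ω.1 - F.real Ω.1|) :=
  ⟨1, by rintro _ ⟨Ω, rfl⟩; exact abs_empMass_sub_le x Ω.1⟩

lemma abs_empMass_sub_le_empDeviation [IsProbabilityMeasure F]
    (x : Fin n → EuclideanSpace ℝ (Fin d)) {Ω : Set (EuclideanSpace ℝ (Fin d))} (hΩ : Ω ∈ 𝒢) :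
    |empMass x Ω - F.real Ω| ≤ empDeviation F 𝒢 x :=
  le_ciSup (bddAbove_empDeviation (F := F) x) (⟨Ω, hΩ⟩ : 𝒢)

lemma abs_empDeviation_le [IsProbabilityMeasure F] (x : Fin n → EuclideanSpace ℝ (Fin d)) :
    |empDeviation F 𝒢 x| ≤ 1 := by
  have h : 0 ≤ empDeviation F 𝒢 x := Real.iSup_nonneg fun _ => abs_nonneg _
  rw [abs_of_nonneg h]
  exact Real.iSup_le (fun Ω => abs_empMass_sub_le x Ω.1) zero_le_one

lemma abs_empMass_update_sub_le (x : Fin n → EuclideanSpace ℝ (Fin d)) (i : Fin n)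
    (a : EuclideanSpace ℝ (Fin d)) (A : Set (EuclideanSpace ℝ (Fin d))) :
    |empMass (Function.update x i a) A - empMass x A| ≤ 1 / n := by
  unfold empMass
  rw [← mul_sub, ← Finset.sum_sub_distrib, Finset.sum_eq_single i]
  · rw [Function.update_self, abs_mul, abs_of_nonneg (by positivity : (0 : ℝ) ≤ 1 / n)]
    refine mul_le_of_le_one_right (by positivity) ?_
    have h1 := indicator_one_mem_Icc A a
    have h2 := indicator_one_mem_Icc A (x i)
    rw [abs_le]
    constructor <;> linarith [h1.1, h1.2, h2.1, h2.2]
  · intro j _ hj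
    rw [Function.update_of_ne hj, sub_self]
  · simp

lemma abs_empDeviation_update_sub_le [IsProbabilityMeasure F] (h𝒢 : 𝒢.Nonempty)
    (x : Fin n → EuclideanSpace ℝ (Fin d)) (i : Fin n) (a : EuclideanSpace ℝ (Fin d)) :
    |empDeviation F 𝒢 (Function.update x i a) - empDeviation F 𝒢 x| ≤ 1 / n := by
  have : Nonempty 𝒢 := h𝒢.to_subtype
  have key : ∀ y z : Fin n → EuclideanSpace ℝ (Fin d),
      (∀ A, |empMass y A - empMass z A| ≤ 1 / n) →
      empDeviation F 𝒢 y - empDeviation F 𝒢 z ≤ 1 / n := by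
    intro y z h
    rw [sub_le_iff_le_add]
    refine ciSup_le fun Ω => ?_
    have h1 := abs_empMass_sub_le_empDeviation (F := F) z Ω.2
    have h2 := abs_sub_le (empMass y Ω.1) (empMass z Ω.1) (F.real Ω.1)
    linarith [h Ω.1]
  rw [abs_le]
  constructor
  · have := key x (Function.update x i a) fun A => by
      rw [abs_sub_comm]; exact abs_empMass_update_sub_le x i a A
    linarith
  · exact key _ _ fun A => abs_empMass_update_sub_le x i a A

/-- McDiarmid with increments `c = 1/n`: the variance proxy is `n (1/(2n))² = 1/(4n)`, whence the
exponent `-2nt²`. -/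
lemma measure_empDeviation_ge_le [IsProbabilityMeasure F] (h𝒢 : 𝒢.Nonempty)
    (hm : AEMeasurable (fun x : Fin n → EuclideanSpace ℝ (Fin d) => empDeviation F 𝒢 x)
      (Measure.pi fun _ : Fin n => F)) (hn : 1 ≤ n) {t : ℝ} (ht : 0 ≤ t) :
    (Measure.pi fun _ : Fin n => F).real
      {x | t ≤ empDeviation F 𝒢 x - ∫ y, empDeviation F 𝒢 y ∂(Measure.pi fun _ : Fin n => F)} ≤
      Real.exp (-(2 * n * t ^ 2)) := by
  have hn' : (n : ℝ) ≠ 0 := by positivity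
  have h := (hasSubgaussianMGF_of_boundedDifferences F (1 / n : NNReal) 1 n _ hm
    abs_empDeviation_le fun x i a => by
      simpa using abs_empDeviation_update_sub_le h𝒢 x i a).measure_ge_le ht
  refine h.trans_eq ?_
  congr 1
  push_cast
  field_simp

/-! ### Symmetrization -/

/-- Choosing each coordinate from one of two independent samples yields again a sample. -/
lemma measurePreserving_ite {E : Type*} [MeasurableSpace E] (μ : Measure E) [IsProbabilityMeasure μ]
    (p : Fin n → Prop) [DecidablePred p] :
    MeasurePreserving (fun z : (Fin n → E) × (Fin n → E) => fun i => if p i then z.1 i else z.2 i)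
      ((Measure.pi fun _ => μ).prod (Measure.pi fun _ => μ)) (Measure.pi fun _ => μ) := by
  have h1 := (measurePreserving_arrowProdEquivProdArrow E E (Fin n) (fun _ => μ) fun _ => μ).symm
  have h2 : MeasurePreserving (fun w : Fin n → E × E => fun i => if p i then (w i).1 else (w i).2)
      (Measure.pi fun _ => μ.prod μ) (Measure.pi fun _ => μ) := by
    refine measurePreserving_pi (fun _ => μ.prod μ) (fun _ => μ)
      (f := fun i w => if p i then w.1 else w.2) fun i => ?_
    by_cases h : p i
    · simpa only [h, if_true] using measurePreserving_fst
    · simpa only [h, if_false] using measurePreserving_snd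
  exact h2.comp h1

lemma bddAbove_rademacherSup (x : Fin n → EuclideanSpace ℝ (Fin d)) (e : Fin n → ℝ) :
    BddAbove (Set.range fun Ω : 𝒢 =>
      (1 / (n : ℝ)) * |∑ i, e i * Ω.1.indicator (fun _ => (1 : ℝ)) (x i)|) := by
  refine ⟨(1 / (n : ℝ)) * ∑ i, |e i|, ?_⟩
  rintro _ ⟨Ω, rfl⟩
  refine mul_le_mul_of_nonneg_left ((Finset.abs_sum_le_sum_abs _ _).trans
    (Finset.sum_le_sum fun i _ => ?_)) (by positivity)
  rw [abs_mul]
  refine mul_le_of_le_one_right (abs_nonneg _) ?_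
  have := indicator_one_mem_Icc Ω.1 (x i)
  rw [abs_of_nonneg this.1]
  exact this.2

lemma rademacherSup_nonneg (x : Fin n → EuclideanSpace ℝ (Fin d)) (e : Fin n → ℝ) :
    0 ≤ rademacherSup 𝒢 x e :=
  Real.iSup_nonneg fun _ => by positivity

lemma rademacherSup_le_one (x : Fin n → EuclideanSpace ℝ (Fin d)) {e : Fin n → ℝ}
    (he : ∀ i, |e i| = 1) : rademacherSup 𝒢 x e ≤ 1 := by
  refine Real.iSup_le (fun Ω => ?_) zero_le_one
  have h1 : |∑ i, e i * Ω.1.indicator (fun _ => (1 : ℝ)) (x i)| ≤ n := by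
    refine (Finset.abs_sum_le_sum_abs _ _).trans ?_
    have : ∀ i ∈ Finset.univ, |e i * Ω.1.indicator (fun _ => (1 : ℝ)) (x i)| ≤ 1 := fun i _ => by
      rw [abs_mul, he i, one_mul, abs_of_nonneg (indicator_one_mem_Icc Ω.1 (x i)).1]
      exact (indicator_one_mem_Icc Ω.1 (x i)).2
    simpa using Finset.sum_le_sum this
  rw [one_div_mul_eq_div]
  exact div_le_one_of_le₀ h1 (Nat.cast_nonneg n)

open Classical in
/-- Exchanging the coordinates of negative sign turns the difference of two empirical masses into a
difference of signed sums. -/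
lemma abs_empMass_sub_empMass_le (y z : Fin n → EuclideanSpace ℝ (Fin d)) {e : Fin n → ℝ}
    (he : ∀ i, |e i| = 1) {Ω : Set (EuclideanSpace ℝ (Fin d))} (hΩ : Ω ∈ 𝒢) :
    |empMass y Ω - empMass z Ω| ≤
      rademacherSup 𝒢 (fun i => if e i = 1 then y i else z i) e +
        rademacherSup 𝒢 (fun i => if e i ≠ 1 then y i else z i) e := by
  have key : ∀ x, (1 / (n : ℝ)) * |∑ i, e i * Ω.indicator (fun _ => (1 : ℝ)) (x i)| ≤
      rademacherSup 𝒢 x e := fun x => le_ciSup (bddAbove_rademacherSup x e) (⟨Ω, hΩ⟩ : 𝒢)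
  refine le_trans ?_ (add_le_add (key _) (key _))
  have h : empMass y Ω - empMass z Ω = (1 / (n : ℝ)) *
      (∑ i, e i * Ω.indicator (fun _ => (1 : ℝ)) (if e i = 1 then y i else z i) -
        ∑ i, e i * Ω.indicator (fun _ => (1 : ℝ)) (if e i ≠ 1 then y i else z i)) := by
    unfold empMass
    rw [← mul_sub, ← Finset.sum_sub_distrib, ← Finset.sum_sub_distrib]
    congr 1
    refine Finset.sum_congr rfl fun i _ => ?_
    rcases eq_or_eq_neg_of_abs_eq (he i) with h | h
    · simp [h]
    · have : ¬ ((-1 : ℝ) = 1) := by norm_num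
      simp only [h, this, if_false, ne_eq, not_false_eq_true, if_true]
      ring
  rw [h, abs_mul, abs_of_nonneg (by positivity : (0 : ℝ) ≤ 1 / n), ← mul_add]
  exact mul_le_mul_of_nonneg_left (abs_sub _ _) (by positivity)

lemma measurable_empMass {A : Set (EuclideanSpace ℝ (Fin d))} (hA : MeasurableSet A) :
    Measurable fun x : Fin n → EuclideanSpace ℝ (Fin d) => empMass x A := by
  unfold empMass
  refine Measurable.const_mul (Finset.measurable_sum _ fun i _ => ?_) _
  exact (measurable_const.indicator hA).comp (measurable_pi_apply i)

lemma integral_empMass [IsProbabilityMeasure F] (hn : 1 ≤ n)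
    {A : Set (EuclideanSpace ℝ (Fin d))} (hA : MeasurableSet A) :
    ∫ x, empMass x A ∂(Measure.pi fun _ : Fin n => F) = F.real A := by
  have hmp : ∀ i : Fin n, MeasurePreserving (Function.eval i) (Measure.pi fun _ : Fin n => F) F :=
    fun i => measurePreserving_eval _ i
  have hi : Integrable (A.indicator fun _ => (1 : ℝ)) F := (integrable_const 1).indicator hA
  have h1 : ∀ i : Fin n, ∫ x, A.indicator (fun _ => (1 : ℝ)) (x i)
      ∂(Measure.pi fun _ : Fin n => F) = F.real A := fun i => by
    have := integral_map (hmp i).measurable.aemeasurable (f := A.indicator fun _ => (1 : ℝ))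
      (by rw [(hmp i).map_eq]; exact hi.aestronglyMeasurable)
    rw [(hmp i).map_eq, integral_indicator hA] at this
    simpa using this.symm
  unfold empMass
  have h2 : ∀ i ∈ Finset.univ, Integrable
      (fun x : Fin n → EuclideanSpace ℝ (Fin d) => A.indicator (fun _ => (1 : ℝ)) (x i))
      (Measure.pi fun _ : Fin n => F) := fun i _ => (hmp i).integrable_comp_of_integrable hi
  rw [integral_const_mul, integral_finsetSum _ h2]
  simp only [h1, Finset.sum_const, Finset.card_univ, Fintype.card_fin, nsmul_eq_mul]
  field_simp

/-- Symmetrization already holds for each fixed sign vector: the two samples mixed from the original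
and a ghost sample each have the law of the original sample, so each contributes one copy of the
right-hand integral. -/
lemma integral_empDeviation_le_of_signs [IsProbabilityMeasure F] (hn : 1 ≤ n)
    (h𝒢 : ∀ Ω ∈ 𝒢, MeasurableSet Ω)
    (hm : AEMeasurable (fun x : Fin n → EuclideanSpace ℝ (Fin d) => empDeviation F 𝒢 x)
      (Measure.pi fun _ : Fin n => F)) {e : Fin n → ℝ} (he : ∀ i, |e i| = 1)
    (hr : AEMeasurable (fun x => rademacherSup 𝒢 x e) (Measure.pi fun _ : Fin n => F)) :
    ∫ x, empDeviation F 𝒢 x ∂(Measure.pi fun _ : Fin n => F) ≤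
      2 * ∫ x, rademacherSup 𝒢 x e ∂(Measure.pi fun _ : Fin n => F) := by
  classical
  set ν : Measure (Fin n → EuclideanSpace ℝ (Fin d)) := Measure.pi fun _ : Fin n => F
  have hri : Integrable (fun x => rademacherSup 𝒢 x e) ν :=
    Integrable.of_bound hr.aestronglyMeasurable 1 (ae_of_all _ fun x => by
      rw [Real.norm_of_nonneg (rademacherSup_nonneg x e)]; exact rademacherSup_le_one x he)
  have hpick : ∀ (p : Fin n → Prop) [DecidablePred p],
      Integrable (fun z : (Fin n → EuclideanSpace ℝ (Fin d)) × (Fin n → EuclideanSpace ℝ (Fin d)) =>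
        rademacherSup 𝒢 (fun i => if p i then z.1 i else z.2 i) e) (ν.prod ν) ∧
      ∫ z, rademacherSup 𝒢 (fun i => if p i then z.1 i else z.2 i) e ∂(ν.prod ν) =
        ∫ x, rademacherSup 𝒢 x e ∂ν := by
    intro p _
    have hp := measurePreserving_ite F p
    refine ⟨hp.integrable_comp_of_integrable hri, ?_⟩
    have := integral_map hp.measurable.aemeasurable (f := fun x => rademacherSup 𝒢 x e)
      (by rw [hp.map_eq]; exact hr.aestronglyMeasurable)
    rw [hp.map_eq] at this
    exact this.symm
  obtain ⟨hi1, he1⟩ := hpick fun i => e i = 1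
  obtain ⟨hi2, he2⟩ := hpick fun i => e i ≠ 1
  have hi := hi1.add hi2
  have hD : Integrable (fun x : Fin n → EuclideanSpace ℝ (Fin d) => empDeviation F 𝒢 x) ν :=
    Integrable.of_bound hm.aestronglyMeasurable 1 (ae_of_all _ fun x => abs_empDeviation_le x)
  calc ∫ y, empDeviation F 𝒢 y ∂ν
      ≤ ∫ y, ∫ z, (rademacherSup 𝒢 (fun i => if e i = 1 then y i else z i) e +
          rademacherSup 𝒢 (fun i => if e i ≠ 1 then y i else z i) e) ∂ν ∂ν := by
        refine integral_mono_ae hD hi.integral_prod_left ?_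
        filter_upwards [hi.prod_right_ae] with y hy
        refine Real.iSup_le (fun Ω => ?_) (integral_nonneg fun z =>
          add_nonneg (rademacherSup_nonneg _ _) (rademacherSup_nonneg _ _))
        have hint : Integrable (fun z : Fin n → EuclideanSpace ℝ (Fin d) => empMass z Ω.1) ν :=
          Integrable.of_bound (measurable_empMass (h𝒢 _ Ω.2)).aestronglyMeasurable 1
            (ae_of_all _ fun z => by
              have := empMass_mem_Icc z Ω.1
              rw [Real.norm_of_nonneg this.1]; exact this.2)
        -- The true mass is the mean empirical mass of the ghost sample `z`; taking absolute values
        -- inside the integral brings the supremum inside as well.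
        have h1 : empMass y Ω.1 - F.real Ω.1 = ∫ z, (empMass y Ω.1 - empMass z Ω.1) ∂ν := by
          rw [integral_sub (integrable_const _) hint, integral_empMass hn (h𝒢 _ Ω.2)]
          simp
        rw [h1]
        refine (abs_integral_le_integral_abs).trans ?_
        exact integral_mono ((integrable_const _).sub hint).abs hy
          fun z => abs_empMass_sub_empMass_le y z he Ω.2
    _ = 2 * ∫ x, rademacherSup 𝒢 x e ∂ν := by
        have := integral_prod _ hi
        simp only [Pi.add_apply] at this
        rw [← this, integral_add hi1 hi2, he1, he2]
        ring

instance isProbabilityMeasure_signLaw : IsProbabilityMeasure signLaw :=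
  ⟨by simp [signLaw, ENNReal.inv_two_add_inv_two]⟩

lemma ae_signLaw_abs_eq_one : ∀ᵐ s ∂signLaw, |s| = 1 := by
  have h : MeasurableSet {s : ℝ | |s| = 1} := measurableSet_eq_fun (by fun_prop) (by fun_prop)
  rw [ae_iff]
  have h' : MeasurableSet {s : ℝ | ¬ |s| = 1} := h.compl
  simp [signLaw, h']

/-- Symmetrization: the expected uniform deviation is at most twice the Rademacher average. -/
lemma integral_empDeviation_le [IsProbabilityMeasure F] (hn : 1 ≤ n)
    (h𝒢 : ∀ Ω ∈ 𝒢, MeasurableSet Ω)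
    (hm : AEMeasurable (fun x : Fin n → EuclideanSpace ℝ (Fin d) => empDeviation F 𝒢 x)
      (Measure.pi fun _ : Fin n => F))
    (hr : AEMeasurable
      (fun p : (Fin n → EuclideanSpace ℝ (Fin d)) × (Fin n → ℝ) => rademacherSup 𝒢 p.1 p.2)
      (sampleSignLaw F n)) :
    ∫ x, empDeviation F 𝒢 x ∂(Measure.pi fun _ : Fin n => F) ≤ 2 * rademacherAvg F 𝒢 n := by
  have hsign : ∀ᵐ e ∂(Measure.pi fun _ : Fin n => signLaw), ∀ i, |e i| = 1 :=
    ae_all_iff.2 fun i =>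
      (Measure.tendsto_eval_ae_ae (μ := fun _ : Fin n => signLaw) (i := i)).eventually
        ae_signLaw_abs_eq_one
  unfold rademacherAvg sampleSignLaw at *
  set ν : Measure (Fin n → EuclideanSpace ℝ (Fin d)) := Measure.pi fun _ : Fin n => F
  set σ : Measure (Fin n → ℝ) := Measure.pi fun _ : Fin n => signLaw
  have hi : Integrable (fun p : (Fin n → EuclideanSpace ℝ (Fin d)) × (Fin n → ℝ) =>
      rademacherSup 𝒢 p.1 p.2) (ν.prod σ) := by
    refine Integrable.of_bound hr.aestronglyMeasurable 1 ?_
    filter_upwards [Measure.quasiMeasurePreserving_snd.ae hsign] with p hp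
    rw [Real.norm_of_nonneg (rademacherSup_nonneg _ _)]
    exact rademacherSup_le_one _ hp
  -- The signs become the outer variable, so that the bound for fixed signs can be averaged.
  rw [integral_prod_symm _ hi, ← integral_const_mul]
  have hc : ∫ x, empDeviation F 𝒢 x ∂ν = ∫ _, (∫ x, empDeviation F 𝒢 x ∂ν) ∂σ := by simp
  rw [hc]
  refine integral_mono_ae (integrable_const _) (hi.integral_prod_right.const_mul _) ?_
  filter_upwards [hsign, hi.prod_left_ae] with e he hie
  exact integral_empDeviation_le_of_signs hn h𝒢 hm he hie.aemeasurable

/-- With probability at least `1 - δ` the uniform deviation is at most the penalty. -/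
lemma measure_penalty_lt_empDeviation_le [IsProbabilityMeasure F] (hn : 1 ≤ n) (h𝒢ne : 𝒢.Nonempty)
    (h𝒢 : ∀ Ω ∈ 𝒢, MeasurableSet Ω)
    (hm : AEMeasurable (fun x : Fin n → EuclideanSpace ℝ (Fin d) => empDeviation F 𝒢 x)
      (Measure.pi fun _ : Fin n => F))
    (hr : AEMeasurable
      (fun p : (Fin n → EuclideanSpace ℝ (Fin d)) × (Fin n → ℝ) => rademacherSup 𝒢 p.1 p.2)
      (sampleSignLaw F n)) {δ : ℝ} (hδ : δ ∈ Set.Ioo (0 : ℝ) 1) :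
    (Measure.pi fun _ : Fin n => F) {x | penalty F 𝒢 δ n < empDeviation F 𝒢 x} ≤
      ENNReal.ofReal δ := by
  have h1 := measure_empDeviation_ge_le h𝒢ne hm hn
    (Real.sqrt_nonneg (Real.log (1 / δ) / (2 * n)))
  have hn' : (n : ℝ) ≠ 0 := by positivity
  have hlog : 0 ≤ Real.log (1 / δ) :=
    Real.log_nonneg (by rw [le_div_iff₀ hδ.1]; linarith [hδ.2])
  -- The deviation `t = √(log(1/δ)/(2n))` makes `exp(-2nt²)` equal to `δ`.
  rw [Real.sq_sqrt (by positivity), mul_div_cancel₀ _ (by positivity), one_div, Real.log_inv,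
    neg_neg, Real.exp_log hδ.1] at h1
  have h2 := integral_empDeviation_le hn h𝒢 hm hr
  refine (measure_mono fun x hx => ?_).trans (ENNReal.le_ofReal_iff_toReal_le
    (measure_ne_top _ _) hδ.1.le |>.2 h1)
  simp only [Set.mem_ofPred_eq, penalty, one_div, Real.log_inv] at hx ⊢
  linarith

end EmpiricalProcess

/-! ### Regularity of the optimal Mass Volume curve -/

section LevelSets

variable {d : ℕ} {F : Measure (EuclideanSpace ℝ (Fin d))} {s : EuclideanSpace ℝ (Fin d) → ℝ}

/-- Dominated convergence: for fixed `x` the indicator of `t ≤ s x` jumps only at `t = s x`, and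
almost no `x` has its jump at a given level. -/
lemma continuous_levelMass [IsProbabilityMeasure F] (hs : Measurable s)
    (hflat : ∀ t, F {x | s x = t} = 0) : Continuous (levelMass F s) := by
  have h : levelMass F s = fun t => ∫ x, {x | t ≤ s x}.indicator (fun _ => (1 : ℝ)) x ∂F := by
    funext t
    rw [integral_indicator (measurableSet_le measurable_const hs)]
    simp [levelMass]
  rw [h, continuous_iff_continuousAt]
  intro t₀
  refine continuousAt_of_dominated (bound := fun _ => 1) ?_ ?_ (integrable_const _) ?_
  · exact .of_forall fun t =>
      (measurable_const.indicator (measurableSet_le measurable_const hs)).aestronglyMeasurable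
  · refine .of_forall fun t => ae_of_all _ fun x => ?_
    have := indicator_one_mem_Icc {x | t ≤ s x} x
    rw [Real.norm_of_nonneg this.1]
    exact this.2
  · have : ∀ᵐ x ∂F, s x ≠ t₀ := by rw [ae_iff]; simpa using hflat t₀
    filter_upwards [this] with x hx
    rcases lt_or_gt_of_ne hx with h | h
    · refine ContinuousAt.congr (f := fun _ => (0 : ℝ)) continuousAt_const ?_
      filter_upwards [lt_mem_nhds h] with t ht
      simp [ht]
    · refine ContinuousAt.congr (f := fun _ => (1 : ℝ)) continuousAt_const ?_
      filter_upwards [gt_mem_nhds h] with t ht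
      simp [ht.le]

/-- Without atoms, `{s ≥ t}` and `{s > t}` have the same mass, so both infima run over the same set
of levels. -/
lemma upperQuantile_eq_levelMassInv [IsProbabilityMeasure F] (hs : Measurable s)
    (hflat : ∀ t, F {x | s x = t} = 0) (α : ℝ) :
    upperQuantile F s α = levelMassInv F s α := by
  unfold upperQuantile levelMassInv levelMass
  congr 1
  ext t
  have h1 : F.real {x | t ≤ s x} = F.real {x | s x ≤ t}ᶜ := by
    refine measureReal_congr ?_
    have : ∀ᵐ x ∂F, s x ≠ t := by rw [ae_iff]; simpa using hflat t
    filter_upwards [this] with x hx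
    refine propext ⟨fun h => ?_, fun h => ?_⟩
    · exact not_le.2 (lt_of_le_of_ne h hx.symm)
    · exact (not_le.1 (show ¬ s x ≤ t from h)).le
  have h2 := probReal_compl_eq_one_sub (μ := F) (measurableSet_le hs (measurable_const (a := t)))
  simp only [Set.mem_ofPred_eq]
  rw [h1, h2]
  constructor <;> intro h <;> linarith

lemma levelMass_of_nonpos [IsProbabilityMeasure F] (hpos : F {x | s x ≤ 0} = 0) {t : ℝ}
    (ht : t ≤ 0) : levelMass F s t = 1 := by
  unfold levelMass
  rw [← probReal_univ (μ := F)]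
  refine measureReal_congr ?_
  have : ∀ᵐ x ∂F, 0 < s x := by rw [ae_iff]; simpa using hpos
  filter_upwards [this] with x hx
  exact propext ⟨fun _ => trivial, fun _ => ht.trans hx.le⟩

lemma bddBelow_levelMass_le [IsProbabilityMeasure F] (hpos : F {x | s x ≤ 0} = 0) {α : ℝ}
    (hα : α < 1) : BddBelow {t : ℝ | levelMass F s t ≤ α} := by
  refine ⟨0, fun t ht => ?_⟩
  by_contra! h
  have : levelMass F s t ≤ α := ht
  rw [levelMass_of_nonpos hpos h.le] at this
  linarith

/-- For a score bounded above, positive and without flat parts, the generalized inverse of the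
mass of the level sets is positive and is a right inverse. -/
lemma levelMassInv_spec [IsProbabilityMeasure F] (hs : Measurable s)
    (hflat : ∀ t, F {x | s x = t} = 0) (hpos : F {x | s x ≤ 0} = 0) {M : ℝ}
    (hM : F {x | M < s x} = 0) {α : ℝ} (hα : α ∈ Set.Ico (0 : ℝ) 1) :
    0 < levelMassInv F s α ∧ levelMass F s (levelMassInv F s α) = α := by
  have hcont := continuous_levelMass hs hflat
  have hne : {t : ℝ | levelMass F s t ≤ α}.Nonempty := by
    -- The level must lie strictly above `M`, as only the strict superlevel set at `M` is known to
    -- be null.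
    refine ⟨M + 1, ?_⟩
    have : F {x | M + 1 ≤ s x} = 0 :=
      measure_mono_null (fun x (hx : M + 1 ≤ s x) => show M < s x by linarith) hM
    simp [levelMass, measureReal_def, this, hα.1]
  have hmem : levelMass F s (levelMassInv F s α) ≤ α :=
    (isClosed_le hcont continuous_const).csInf_mem hne (bddBelow_levelMass_le hpos hα.2)
  refine ⟨?_, hmem.antisymm ?_⟩
  · by_contra! h
    rw [levelMass_of_nonpos hpos h] at hmem
    linarith [hα.2]
  -- To the left of the infimum the mass exceeds `α`; pass to the limit by continuity.
  · refine ge_of_tendsto (hcont.continuousAt.tendsto.mono_left nhdsWithin_le_nhds :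
      Filter.Tendsto _ (nhdsWithin (levelMassInv F s α) (Set.Iio (levelMassInv F s α))) _) ?_
    filter_upwards [self_mem_nhdsWithin] with t ht
    by_contra! h
    exact (csInf_le (bddBelow_levelMass_le hpos hα.2) h.le).not_gt ht

variable {𝒳 : Set (EuclideanSpace ℝ (Fin d))} {f : EuclideanSpace ℝ (Fin d) → ℝ}

lemma isProbabilityMeasure_law (hf_int : ∫⁻ x in 𝒳, ENNReal.ofReal (f x) = 1) :
    IsProbabilityMeasure (law 𝒳 f) :=
  ⟨by simpa [law] using hf_int⟩

lemma ae_law_mem (h𝒳 : MeasurableSet 𝒳) : ∀ᵐ x ∂(law 𝒳 f), x ∈ 𝒳 :=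
  (withDensity_absolutelyContinuous _ _).ae_le (ae_restrict_mem h𝒳)

lemma law_nonpos (hf : Measurable f) : law 𝒳 f {x | f x ≤ 0} = 0 := by
  have hm : MeasurableSet {x | f x ≤ 0} := measurableSet_le hf measurable_const
  rw [law, withDensity_apply _ hm, setLIntegral_congr_fun hm
    (g := fun _ => 0) fun x hx => ENNReal.ofReal_of_nonpos hx]
  simp

/-- Levels `t ≤ 0` need no assumption: they lie in `{f ≤ 0}`, which is null because `f` is its own
density. -/
lemma law_flat (hf : Measurable f) (hf_flat : ∀ t : ℝ, 0 < t → law 𝒳 f {x | f x = t} = 0) (t : ℝ) :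
    law 𝒳 f {x | f x = t} = 0 := by
  rcases lt_or_ge 0 t with h | h
  · exact hf_flat t h
  · exact measure_mono_null (fun x (hx : f x = t) => show f x ≤ 0 from hx.trans_le h)
      (law_nonpos hf)

lemma law_bdd (h𝒳 : MeasurableSet 𝒳) {M : ℝ} (hM : ∀ x ∈ 𝒳, f x ≤ M) :
    law 𝒳 f {x | M < f x} = 0 := by
  have := ae_law_mem (f := f) h𝒳
  rw [ae_iff] at this
  exact measure_mono_null (fun x (hx : M < f x) h => (hM x h).not_gt hx) this

/-- Integrate the lower bound on the density. This yields both the finite volume of level sets and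
the Lipschitz bound on the curve. -/
lemma ofReal_mul_volume_le_law {A : Set (EuclideanSpace ℝ (Fin d))} (hA : MeasurableSet A)
    (hA𝒳 : A ⊆ 𝒳) {q : ℝ} (hq : ∀ x ∈ A, q ≤ f x) :
    ENNReal.ofReal q * volume A ≤ law 𝒳 f A := by
  rw [law, withDensity_apply _ hA, Measure.restrict_restrict hA, Set.inter_eq_left.2 hA𝒳,
    ← setLIntegral_const]
  exact setLIntegral_mono' hA fun x hx => ENNReal.ofReal_le_ofReal (hq x hx)

/-- Facts on the optimal curve that follow from boundedness and the absence of flat parts. -/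
lemma qStar_mvStar_spec (h𝒳 : MeasurableSet 𝒳) (hf : Measurable f)
    (hf_int : ∫⁻ x in 𝒳, ENNReal.ofReal (f x) = 1) (hf_bdd : ∃ M : ℝ, ∀ x ∈ 𝒳, f x ≤ M)
    (hf_flat : ∀ t : ℝ, 0 < t → law 𝒳 f {x | f x = t} = 0) {γ : ℝ} (hγ : γ ∈ Set.Ico (0 : ℝ) 1) :
    0 < qStar 𝒳 f γ ∧ ∀ β ∈ Set.Icc 0 γ,
      (∀ Ω, IsMinVolumeSet 𝒳 (law 𝒳 f) β Ω → volume.real Ω ≤ mvStar 𝒳 f β) ∧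
      ∀ α ∈ Set.Icc 0 β, mvStar 𝒳 f α ≤ mvStar 𝒳 f β ∧
        mvStar 𝒳 f β - mvStar 𝒳 f α ≤ 1 / qStar 𝒳 f γ * (β - α) := by
  have := isProbabilityMeasure_law hf_int
  obtain ⟨M, hM⟩ := hf_bdd
  have hflat := law_flat hf hf_flat
  have hspec := fun {α : ℝ} (hα : α ∈ Set.Ico (0 : ℝ) 1) =>
    levelMassInv_spec hf hflat (law_nonpos hf) (law_bdd h𝒳 hM) hα
  have hq : qStar 𝒳 f γ = levelMassInv (law 𝒳 f) f γ := upperQuantile_eq_levelMassInv hf hflat γ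
  set q := levelMassInv (law 𝒳 f) f
  set L : ℝ → Set (EuclideanSpace ℝ (Fin d)) := fun α => {x ∈ 𝒳 | q α ≤ f x}
  have hLm : ∀ α, MeasurableSet (L α) := fun α => h𝒳.inter (measurableSet_le measurable_const hf)
  have hmass : ∀ α ∈ Set.Ico (0 : ℝ) 1, (law 𝒳 f).real (L α) = α := by
    intro α hα
    refine Eq.trans (measureReal_congr ?_) (hspec hα).2
    filter_upwards [ae_law_mem (f := f) h𝒳] with x hx
    exact propext ⟨fun h => h.2, fun h => ⟨hx, h⟩⟩
  -- Finiteness matters because `volume.real` sends infinite volume to 0, which would break the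
  -- comparisons below.
  have hfin : ∀ α ∈ Set.Ico (0 : ℝ) 1, volume (L α) ≠ ⊤ := by
    intro α hα htop
    have h := ofReal_mul_volume_le_law (f := f) (hLm α) (fun x hx => hx.1) fun x hx => hx.2
    rw [htop, ENNReal.mul_top (by simpa using (hspec hα).1)] at h
    exact (measure_ne_top _ _) (top_le_iff.1 h)
  have hqle : ∀ α ∈ Set.Ico (0 : ℝ) 1, ∀ β ∈ Set.Ico (0 : ℝ) 1, α ≤ β → q β ≤ q α :=
    fun α hα β hβ hαβ =>
      csInf_le (bddBelow_levelMass_le (law_nonpos hf) hβ.2) ((hspec hα).2.trans_le hαβ)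
  refine ⟨hq ▸ (hspec hγ).1, fun β hβγ => ?_⟩
  have hβ : β ∈ Set.Ico (0 : ℝ) 1 := ⟨hβγ.1, hβγ.2.trans_lt hγ.2⟩
  refine ⟨fun Ω hΩ => ?_, fun α hα => ?_⟩
  -- The level set has mass exactly `β`, so it competes in the minimum volume problem.
  · exact ENNReal.toReal_mono (hfin β hβ)
      (hΩ.2 (L β) (fun x hx => hx.1) (hLm β) (hmass β hβ).ge)
  · have hα' : α ∈ Set.Ico (0 : ℝ) 1 := ⟨hα.1, hα.2.trans_lt hβ.2⟩
    have hsub : L α ⊆ L β := fun x hx => ⟨hx.1, (hqle α hα' β hβ hα.2).trans hx.2⟩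
    refine ⟨measureReal_mono hsub (hfin β hβ), ?_⟩
    have hvol : volume.real (L β \ L α) = mvStar 𝒳 f β - mvStar 𝒳 f α :=
      measureReal_sdiff hsub (hLm α) (hfin β hβ)
    have hlaw : (law 𝒳 f).real (L β \ L α) = β - α := by
      rw [measureReal_sdiff hsub (hLm α), hmass β hβ, hmass α hα']
    -- On the band the density is at least `q β`, hence at least `q γ`, since `q` decreases with the
    -- mass.
    have h := ENNReal.toReal_mono (measure_ne_top _ _) (ofReal_mul_volume_le_law (f := f)
      (q := q γ) ((hLm β).diff (hLm α)) (fun x hx => hx.1.1)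
      fun x hx => (hqle β hβ γ hγ hβγ.2).trans hx.1.2)
    rw [ENNReal.toReal_mul, ENNReal.toReal_ofReal (hspec hγ).1.le] at h
    rw [hq, one_div_mul_eq_div, le_div_iff₀ (hspec hγ).1, ← hvol, ← hlaw, mul_comm]
    exact h

end LevelSets

/-! ### The dyadic tree and its piecewise constant estimator -/

section DyadicTree

variable {ε τ : ℝ} {J : ℕ} {v : ℝ → ℝ}

/-- After rescaling, `k` is the integer part of `2^j α / (1 - ε)`; disjointness and nesting of the
intervals become integer arithmetic. -/
lemma mem_Ico_dyadicLevel_iff (hε : ε < 1) {j k : ℕ} {α : ℝ} :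
    α ∈ Set.Ico (dyadicLevel ε j k) (dyadicLevel ε j (k + 1)) ↔
      (k : ℝ) ≤ α / (1 - ε) * 2 ^ j ∧ α / (1 - ε) * 2 ^ j < k + 1 := by
  have h : 0 < 1 - ε := by linarith
  unfold dyadicLevel
  rw [Set.mem_Ico, div_le_iff₀ (by positivity), lt_div_iff₀ (by positivity),
    div_mul_eq_mul_div, le_div_iff₀ h, div_lt_iff₀ h]
  push_cast
  rfl

lemma eq_of_mem_Ico_dyadicLevel (hε : ε < 1) {j k k' : ℕ} {α : ℝ}
    (h : α ∈ Set.Ico (dyadicLevel ε j k) (dyadicLevel ε j (k + 1)))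
    (h' : α ∈ Set.Ico (dyadicLevel ε j k') (dyadicLevel ε j (k' + 1))) : k = k' := by
  rw [mem_Ico_dyadicLevel_iff hε] at h h'
  have h1 : (k : ℝ) < k' + 1 := h.1.trans_lt h'.2
  have h2 : (k' : ℝ) < k + 1 := h'.1.trans_lt h.2
  norm_cast at h1 h2
  omega

lemma mem_Ico_dyadicLevel_parent (hε : ε < 1) {j k : ℕ} {α : ℝ}
    (h : α ∈ Set.Ico (dyadicLevel ε (j + 1) k) (dyadicLevel ε (j + 1) (k + 1))) :
    α ∈ Set.Ico (dyadicLevel ε j (k / 2 : ℕ)) (dyadicLevel ε j ((k / 2 : ℕ) + 1)) := by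
  rw [mem_Ico_dyadicLevel_iff hε] at h ⊢
  have h1 : ((k / 2 : ℕ) : ℝ) * 2 ≤ k := by norm_cast; omega
  have h2 : (k : ℝ) + 1 ≤ ((k / 2 : ℕ) : ℝ) * 2 + 2 := by norm_cast; omega
  rw [pow_succ] at h
  constructor <;> linarith [h.1, h.2]

/-- Every interval that contains a point of a node and lies higher in the tree is split. -/
lemma Splits_of_isNode (hε : ε < 1) {α : ℝ} {j k : ℕ}
    (h : α ∈ Set.Ico (dyadicLevel ε j k) (dyadicLevel ε j (k + 1))) :
    ∀ {j' k' : ℕ}, j < j' → IsNode ε τ J v j' k' →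
      α ∈ Set.Ico (dyadicLevel ε j' k') (dyadicLevel ε j' (k' + 1)) → Splits ε τ J v j k := by
  intro j'
  induction j' with
  | zero => intro k' hj; exact absurd hj (Nat.not_lt_zero _)
  | succ i ih =>
    intro k' hj hnode hk'
    have hp := mem_Ico_dyadicLevel_parent hε hk'
    rcases Nat.lt_succ_iff_lt_or_eq.1 hj with hlt | rfl
    · exact ih hlt hnode.1 hp
    · rw [eq_of_mem_Ico_dyadicLevel hε h hp]
      exact hnode.2

/-- Of two leaves of different depth through one point, the shallower would be an ancestor of the
other and so be split. -/
lemma isLeaf_unique (hε : ε < 1) {α : ℝ} {j k j' k' : ℕ}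
    (hl : IsLeaf ε τ J v j k) (h : α ∈ Set.Ico (dyadicLevel ε j k) (dyadicLevel ε j (k + 1)))
    (hl' : IsLeaf ε τ J v j' k')
    (h' : α ∈ Set.Ico (dyadicLevel ε j' k') (dyadicLevel ε j' (k' + 1))) : j = j' ∧ k = k' := by
  rcases lt_trichotomy j j' with hj | rfl | hj
  · exact absurd (Splits_of_isNode hε h hj hl'.1 h') hl.2
  · exact ⟨rfl, eq_of_mem_Ico_dyadicLevel hε h h'⟩
  · exact absurd (Splits_of_isNode hε h' hj hl.1 h) hl'.2

/-- The tree estimator vanishes or takes the value attached to a leaf that contains the point. -/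
lemma treeEstimator_eq (hε : ε < 1) (α : ℝ) :
    treeEstimator ε τ J v α = 0 ∨ ∃ j k, j ≤ J ∧ k < 2 ^ j ∧ IsLeaf ε τ J v j k ∧
      α ∈ Set.Ico (dyadicLevel ε j k) (dyadicLevel ε j (k + 1)) ∧
      treeEstimator ε τ J v α = v (dyadicLevel ε j (k + 1)) := by
  classical
  by_cases h : ∃ j k, j ≤ J ∧ k < 2 ^ j ∧ IsLeaf ε τ J v j k ∧
      α ∈ Set.Ico (dyadicLevel ε j k) (dyadicLevel ε j (k + 1))
  · obtain ⟨j, k, hj, hk, hl, hα⟩ := h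
    refine Or.inr ⟨j, k, hj, hk, hl, hα, ?_⟩
    unfold treeEstimator
    rw [Finset.sum_eq_single j, Finset.sum_eq_single k, if_pos ⟨hl, hα⟩]
    · intro k' _ hne
      exact if_neg fun h => hne (isLeaf_unique hε h.1 h.2 hl hα).2
    · intro hk'
      exact absurd (Finset.mem_range.2 hk) hk'
    · intro j' _ hne
      exact Finset.sum_eq_zero fun k' _ =>
        if_neg fun h => hne (isLeaf_unique hε h.1 h.2 hl hα).1
    · intro hj'
      exact absurd (Finset.mem_range.2 (Nat.lt_succ_of_le hj)) hj'
  · refine Or.inl (Finset.sum_eq_zero fun j hj => Finset.sum_eq_zero fun k hk => if_neg fun hc => ?_)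
    exact h ⟨j, k, Nat.lt_succ_iff.1 (Finset.mem_range.1 hj), Finset.mem_range.1 hk, hc⟩

/-- The `+ 1` in the depth compensates for the floor, so intervals of maximal depth have length at
most `1/n`. -/
lemma natCast_le_two_pow_maxDepth {n : ℕ} (hn : 1 ≤ n) : (n : ℝ) ≤ 2 ^ maxDepth n := by
  have hn0 : (0 : ℝ) < n := by exact_mod_cast hn
  have h2 : 0 < Real.log 2 := Real.log_pos (by norm_num)
  have h : Real.log n / Real.log 2 ≤ (maxDepth n : ℝ) := by
    unfold maxDepth
    push_cast
    exact (Nat.lt_floor_add_one _).le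
  rw [div_le_iff₀ h2, ← Real.log_pow] at h
  exact (Real.log_le_log_iff hn0 (by positivity)).1 h

/-- If the node values lie below a monotone Lipschitz curve, then the tree estimator exceeds the
curve by at most the tolerance plus the oscillation over an interval of maximal depth. -/
lemma treeEstimator_sub_le (hε : ε < 1) (hτ : 0 ≤ τ) {m : ℝ → ℝ} {K : ℝ} (hK : 0 ≤ K)
    (hε0 : 0 ≤ ε)
    (hm0 : ∀ α, 0 ≤ m α) (hvm : ∀ α ∈ Set.Icc 0 (1 - ε), v α ≤ m α)
    (hm : ∀ β ∈ Set.Icc 0 (1 - ε), ∀ α ∈ Set.Icc 0 β, m α ≤ m β ∧ m β - m α ≤ K * (β - α))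
    {n : ℕ} (hn : 1 ≤ n) {α : ℝ} (hα : α ∈ Set.Icc 0 (1 - ε)) :
    treeEstimator ε τ (maxDepth n) v α - m α ≤ τ + K * (1 / n) := by
  have hn0 : (0 : ℝ) < n := by exact_mod_cast hn
  have h1ε : 0 < 1 - ε := by linarith
  have hKn : 0 ≤ K * (1 / n) := by positivity
  rcases treeEstimator_eq (τ := τ) (J := maxDepth n) (v := v) hε α with h | ⟨j, k, hj, hk, hl, hαI, h⟩
  -- This case does occur: `α = 1 - ε` lies in no half-open leaf, so the sum is 0 there.
  · linarith [hm0 α]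
  have hk' : ((k + 1 : ℕ) : ℝ) ≤ 2 ^ j := by exact_mod_cast hk
  have hlo : 0 ≤ dyadicLevel ε j k := by unfold dyadicLevel; positivity
  have hhi : dyadicLevel ε j (k + 1) ≤ 1 - ε := by
    unfold dyadicLevel
    rw [div_le_iff₀ (by positivity), mul_comm (1 - ε)]
    exact mul_le_mul_of_nonneg_right hk' h1ε.le
  have hgap : dyadicLevel ε j (k + 1) - dyadicLevel ε j k = (1 - ε) / 2 ^ j := by
    unfold dyadicLevel; push_cast; ring
  rw [h]
  by_cases hjJ : j < maxDepth n
  -- Stopped by the tolerance: compare through the left endpoint, where `m` is at most `m α`.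
  · have herr : localError ε v j k ≤ τ := not_lt.1 fun hc => hl.2 ⟨hjJ, hc⟩
    unfold localError at herr
    have h1 := hvm _ ⟨hlo, hαI.1.trans hα.2⟩
    have h2 := (hm α hα _ ⟨hlo, hαI.1⟩).1
    linarith
  -- Stopped by the depth: compare at the right endpoint and pay the Lipschitz cost of returning to
  -- `α`.
  · have hjeq : j = maxDepth n := le_antisymm hj (not_lt.1 hjJ)
    have hmem : dyadicLevel ε j (k + 1) ∈ Set.Icc 0 (1 - ε) := ⟨hα.1.trans hαI.2.le, hhi⟩
    have h1 := hvm _ hmem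
    have h2 := (hm _ hmem α ⟨hα.1, hαI.2.le⟩).2
    have h3 : (1 - ε) / 2 ^ j ≤ 1 / n := by
      rw [hjeq]
      exact div_le_div₀ zero_le_one (by linarith) hn0 (natCast_le_two_pow_maxDepth hn)
    have h4 : K * (dyadicLevel ε j (k + 1) - α) ≤ K * (1 / n) :=
      mul_le_mul_of_nonneg_left (by linarith [hαI.1]) hK
    linarith

end DyadicTree

/-! ### The corollary -/

lemma penalty_nonneg {d : ℕ} (F : Measure (EuclideanSpace ℝ (Fin d)))
    (𝒢 : Set (Set (EuclideanSpace ℝ (Fin d)))) (δ : ℝ) (n : ℕ) : 0 ≤ penalty F 𝒢 δ n :=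
  add_nonneg (mul_nonneg zero_le_two (integral_nonneg fun _ => rademacherSup_nonneg _ _))
    (Real.sqrt_nonneg _)

theorem mainTheorem7 {d : ℕ}
    -- the feature space and the density
    (𝒳 : Set (EuclideanSpace ℝ (Fin d))) (h𝒳 : MeasurableSet 𝒳)
    (f : EuclideanSpace ℝ (Fin d) → ℝ) (hf_meas : Measurable f)
    (hf_nonneg : ∀ x ∈ 𝒳, 0 ≤ f x)
    (hf_int : ∫⁻ x in 𝒳, ENNReal.ofReal (f x) = 1)
    -- the density is bounded and has no flat parts
    (hf_bdd : ∃ M : ℝ, ∀ x ∈ 𝒳, f x ≤ M)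
    (hf_flat : ∀ t : ℝ, 0 < t → law 𝒳 f {x | f x = t} = 0)
    (ε : ℝ) (hε : ε ∈ Set.Ioo (0 : ℝ) 1) (δ : ℝ) (hδ : δ ∈ Set.Ioo (0 : ℝ) 1)
    -- the class of sets; the two suprema over it are measurable
    (𝒢 : Set (Set (EuclideanSpace ℝ (Fin d))))
    (h𝒢 : ∀ Ω ∈ 𝒢, Ω ⊆ 𝒳 ∧ MeasurableSet Ω ∧ volume Ω < ⊤)
    (h𝒢_dev : ∀ n : ℕ, 1 ≤ n → AEMeasurable
      (fun x : Fin n → EuclideanSpace ℝ (Fin d) => empDeviation (law 𝒳 f) 𝒢 x)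
      (Measure.pi fun _ : Fin n => law 𝒳 f))
    (h𝒢_rad : ∀ n : ℕ, 1 ≤ n → AEMeasurable
      (fun p : (Fin n → EuclideanSpace ℝ (Fin d)) × (Fin n → ℝ) => rademacherSup 𝒢 p.1 p.2)
      (sampleSignLaw (law 𝒳 f) n))
    -- the class contains minimum volume sets of all levels in `[0, 1 - ε]`
    (hmv : ∀ α ∈ Set.Icc 0 (1 - ε), ∃ Ω ∈ 𝒢, IsMinVolumeSet 𝒳 (law 𝒳 f) α Ω)
    -- Rademacher averages
    (C : ℝ) (hC : 0 < C)
    (hrad : ∀ n : ℕ, 1 ≤ n → rademacherAvg (law 𝒳 f) 𝒢 n ≤ C * (n : ℝ) ^ (-(1 / 2) : ℝ))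
    -- the optimal curve is differentiable with derivative `1 / Q*`, which lies in `L log L`
    (hderiv : ∀ α ∈ Set.Ico (0 : ℝ) 1,
      HasDerivWithinAt (mvStar 𝒳 f) (1 / qStar 𝒳 f α) (Set.Ico 0 1) α)
    (hLLogL : MemLLogL (deriv (mvStar 𝒳 f)))
    -- estimated minimum volume sets, as functions of the sample and of the level
    (Ωhat : (n : ℕ) → (Fin n → EuclideanSpace ℝ (Fin d)) → ℝ → Set (EuclideanSpace ℝ (Fin d)))
    (hΩhat : ∀ n : ℕ, 1 ≤ n → ∀ x : Fin n → EuclideanSpace ℝ (Fin d), (∀ i, x i ∈ 𝒳) →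
      ∀ α ∈ Set.Icc 0 (1 - ε),
        (∃ Ω ∈ 𝒢, α - penalty (law 𝒳 f) 𝒢 δ n ≤ empMass x Ω) →
          IsEmpMinVolumeSet 𝒢 x (penalty (law 𝒳 f) 𝒢 δ n) α (Ωhat n x α))
    -- the observations
    {S : Type*} [MeasurableSpace S] (P : Measure S) [IsProbabilityMeasure P]
    (X : ℕ → S → EuclideanSpace ℝ (Fin d)) (hX_meas : ∀ i, Measurable (X i))
    (hX_indep : iIndepFun X P) (hX_law : ∀ i, P.map (X i) = law 𝒳 f) :
    (∀ n : ℕ, 1 ≤ n →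
      ∃ A : Set S, MeasurableSet A ∧ ENNReal.ofReal (1 - δ) ≤ P A ∧
        ∀ ω ∈ A, ∀ α ∈ Set.Icc 0 (1 - ε),
          mvHat ε (5 * penalty (law 𝒳 f) 𝒢 δ n / qStar 𝒳 f (1 - ε)) n
              (Ωhat n fun i : Fin n => X i ω) α - mvStar 𝒳 f α ≤
            1 / qStar 𝒳 f (1 - ε) *
              (11 * (2 * C / Real.sqrt n + Real.sqrt (Real.log (1 / δ) / (2 * n))) + 1 / n)) ∧
    (fun n : ℕ => 1 / qStar 𝒳 f (1 - ε) *
        (11 * (2 * C / Real.sqrt n + Real.sqrt (Real.log (1 / δ) / (2 * n))) + 1 / n))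
      =O[Filter.atTop] (fun n : ℕ => (n : ℝ) ^ (-(1 / 2) : ℝ)) := by
  have hprob := isProbabilityMeasure_law hf_int
  have hγ : 1 - ε ∈ Set.Ico (0 : ℝ) 1 := ⟨by linarith [hε.2], by linarith [hε.1]⟩
  obtain ⟨hq, hspec⟩ := qStar_mvStar_spec h𝒳 hf_meas hf_int hf_bdd hf_flat hγ
  have hrpow : ∀ n : ℕ, (n : ℝ) ^ (-(1 / 2) : ℝ) = 1 / Real.sqrt n := fun n => by
    rw [Real.rpow_neg (Nat.cast_nonneg n), Real.sqrt_eq_rpow, one_div, one_div]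
  refine ⟨fun n hn => ?_, ?_⟩
  -- Any level would do; the set only witnesses that the class is nonempty.
  · obtain ⟨Ω₀, hΩ₀, -⟩ := hmv 0 ⟨le_rfl, hγ.1⟩
    set φ := penalty (law 𝒳 f) 𝒢 δ n with hφ
    set K := 1 / qStar 𝒳 f (1 - ε) with hK
    have hφ0 : 0 ≤ φ := penalty_nonneg _ _ _ _
    have hK0 : 0 ≤ K := (one_div_pos.2 hq).le
    set ν : Measure (Fin n → EuclideanSpace ℝ (Fin d)) := Measure.pi fun _ => law 𝒳 f
    -- Samples leaving `𝒳` are null, and are discarded because the estimator is specified only for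
    -- samples inside `𝒳`.
    set bad : Set (Fin n → EuclideanSpace ℝ (Fin d)) :=
      {x | φ < empDeviation (law 𝒳 f) 𝒢 x} ∪ {x | ¬ ∀ i, x i ∈ 𝒳} with hbad
    have hν : ν bad ≤ ENNReal.ofReal δ := by
      have h1 : ν {x | ¬ ∀ i, x i ∈ 𝒳} = 0 := by
        rw [← ae_iff]
        exact ae_all_iff.2 fun i => (Measure.tendsto_eval_ae_ae (μ := fun _ : Fin n => law 𝒳 f)
          (i := i)).eventually (ae_law_mem h𝒳)
      refine (measure_union_le _ _).trans ?_
      rw [h1, add_zero]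
      exact measure_penalty_lt_empDeviation_le hn ⟨Ω₀, hΩ₀⟩ (fun Ω hΩ => (h𝒢 Ω hΩ).2.1)
        (h𝒢_dev n hn) (h𝒢_rad n hn) hδ
    set Y : S → Fin n → EuclideanSpace ℝ (Fin d) := fun ω i => X i ω
    have hY : Measurable Y := measurable_pi_lambda _ fun i => hX_meas i
    have hYlaw : P.map Y = ν := by
      have h := (iIndepFun_iff_map_fun_eq_pi_map (fun i : Fin n => (hX_meas i).aemeasurable)).1
        (hX_indep.precomp Fin.val_injective)
      simp only [hX_law] at h
      exact h
    -- The deviation is only almost everywhere measurable, so the bad set is replaced by a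
    -- measurable hull of the same measure.
    have hB : MeasurableSet (toMeasurable ν bad) := measurableSet_toMeasurable _ _
    refine ⟨(Y ⁻¹' toMeasurable ν bad)ᶜ, (hY hB).compl, ?_, fun ω hω α hα => ?_⟩
    · rw [prob_compl_eq_one_sub (hY hB), ← Measure.map_apply hY hB, hYlaw, measure_toMeasurable,
        ENNReal.ofReal_sub _ hδ.1.le, ENNReal.ofReal_one]
      exact tsub_le_tsub_left hν _
    · have hgood : Y ω ∉ bad := fun h => hω (subset_toMeasurable _ _ h)
      obtain ⟨hdev, hmem⟩ : empDeviation (law 𝒳 f) 𝒢 (Y ω) ≤ φ ∧ ∀ i, Y ω i ∈ 𝒳 := by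
        simpa [hbad] using hgood
      have hv : ∀ β ∈ Set.Icc 0 (1 - ε), volume.real (Ωhat n (Y ω) β) ≤ mvStar 𝒳 f β := by
        intro β hβ
        obtain ⟨Ω, hΩ, hmin⟩ := hmv β hβ
        -- The true set is feasible: its mass is at least `β`, and its empirical mass is lower by at
        -- most `φ`.
        have hfeas : β - φ ≤ empMass (Y ω) Ω := by
          have h1 := (abs_le.1 ((abs_empMass_sub_le_empDeviation (F := law 𝒳 f) (Y ω) hΩ).trans
            hdev)).1
          linarith [hmin.1.2.2]
        have hsol := hΩhat n hn (Y ω) hmem β hβ ⟨Ω, hΩ, hfeas⟩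
        exact (ENNReal.toReal_mono (h𝒢 Ω hΩ).2.2.ne (hsol.2 Ω hΩ hfeas)).trans
          ((hspec β hβ).1 Ω hmin)
      have htree := treeEstimator_sub_le (τ := 5 * φ / qStar 𝒳 f (1 - ε)) hε.2 (by positivity) hK0
        hε.1.le (fun β => measureReal_nonneg) hv (fun β hβ => (hspec β hβ).2) hn hα
      refine htree.trans ?_
      have hφle : φ ≤ 2 * C / Real.sqrt n + Real.sqrt (Real.log (1 / δ) / (2 * n)) := by
        have h := hrad n hn
        rw [hrpow, mul_one_div] at h
        rw [hφ, penalty, mul_div_assoc]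
        linarith
      have h5 : 5 * φ / qStar 𝒳 f (1 - ε) = K * (5 * φ) := by rw [hK, one_div_mul_eq_div]
      rw [h5, ← mul_add]
      -- The argument produces `5φ`; the constant 11 leaves slack.
      exact mul_le_mul_of_nonneg_left (by linarith) hK0
  · have hO : (fun n : ℕ => 1 / qStar 𝒳 f (1 - ε) *
        (11 * (2 * C / Real.sqrt n + Real.sqrt (Real.log (1 / δ) / (2 * n))) + 1 / n)) =
        fun n : ℕ => 1 / qStar 𝒳 f (1 - ε) *
          (11 * (2 * C + Real.sqrt (Real.log (1 / δ) / 2)) + 1 / Real.sqrt n) *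
            (n : ℝ) ^ (-(1 / 2) : ℝ) := by
      -- The identity includes `n = 0`, where every quotient and the negative power are 0 by
      -- convention.
      funext n
      have h1 : Real.sqrt (Real.log (1 / δ) / (2 * n)) =
          Real.sqrt (Real.log (1 / δ) / 2) * (1 / Real.sqrt n) := by
        rw [← div_div, Real.sqrt_div' _ (Nat.cast_nonneg n), mul_one_div]
      have h2 : 1 / (n : ℝ) = 1 / Real.sqrt n * (1 / Real.sqrt n) := by
        rw [one_div_mul_one_div, Real.mul_self_sqrt (Nat.cast_nonneg n)]
      rw [h1, h2, hrpow]
      ring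
    rw [hO]
    refine Asymptotics.IsBigO.of_bound (1 / qStar 𝒳 f (1 - ε) *
      (11 * (2 * C + Real.sqrt (Real.log (1 / δ) / 2)) + 1)) ?_
    filter_upwards [Filter.eventually_ge_atTop 1] with n hn
    rw [norm_mul]
    refine mul_le_mul_of_nonneg_right ?_ (norm_nonneg _)
    have hs : 1 / Real.sqrt n ≤ 1 := by
      rw [div_le_one (by positivity)]
      exact Real.one_le_sqrt.2 (by exact_mod_cast hn)
    rw [Real.norm_of_nonneg (by positivity)]
    gcongr
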